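/- All graphs are finite and simple. The corona of a graph $T$ is obtained from $T$ by adding, for each vertex $v$ of $T$, a new vertex $v'$ and the edge $vv'$. A vertex is simplicial if its neighborhood induces a complete subgraph. The clique graph of $G$ has the maximal complete subgraphs of $G$ as its vertices, two distinct ones being adjacent if and only if they intersect. Let $\mathcal F$ be the family of all graphs that are, up to isomorphism, obtained as follows. Let $T_1,\dots,T_q$ ($q\ge 1$) be trees of order at least $2$, and let $L_i$ be the line graph of the corona of $T_i$. If $q=1$, let $G=L_1$. If $q\ge 2$, choose $q-1$ pairs of vertices of the disjoint union of $L_1,\dots,L_q$ such that the two vertices of each pair are simplicial vertices of $L_i$ and $L_j$, respectively, for some $i\ne j$; all $2(q-1)$ chosen vertices are distinct; and contracting each pair into one common vertex results in a graph whose clique graph is a tree. Let $G$ be the resulting graph. A partition $(A,B)$ of the vertex set of a graph $G$ of order $n$ is associated with $G$ if $|A|=\frac12(n-1)$, $|B|=\frac12(n+1)$, $B$ is an independent set, and each vertex in $A$ has exactly two neighbors in $B$. Let $\alpha(G)$ be the maximum cardinality of an independent set of $G$, and let $\Gamma(G)$ be the maximum cardinality of a minimal dominating set of $G$. An $\alpha$-set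 is an independent set of cardinality $\alpha(G)$, and a $\Gamma$-set is a minimal dominating set of cardinality $\Gamma(G)$. **Corollary.** Let $G\in\mathcal F$. Then $G$ has an associated partition, and if $(A,B)$ is a partition associated with $G$, then $B$ is the unique $\alpha$-set of $G$ and the unique $\Gamma$-set of $G$. -/

import Mathlib

namespace Favaron

/-- `S` is a dominating set of `G`: every vertex belongs to `S` or has a neighbor in `S`. -/
def IsDominating {V : Type*} (G : SimpleGraph V) (S : Finset V) : Prop :=
  ∀ v, ∃ u ∈ S, u = v ∨ G.Adj u v

/-- `S` is a dominating set of which no proper subset is dominating. -/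
def IsMinimalDominating {V : Type*} (G : SimpleGraph V) (S : Finset V) : Prop :=
  Minimal (IsDominating G) S

/-- The upper domination number `Γ(G)`: the maximum cardinality of a minimal dominating set.
For a finite graph this set of numbers is non-empty and bounded. -/
noncomputable def upperDominationNumber {V : Type*} (G : SimpleGraph V) : ℕ :=
  sSup {k | ∃ S : Finset V, IsMinimalDominating G S ∧ S.card = k}

/-- A `Γ`-set: a minimal dominating set of cardinality `Γ(G)`. -/
def IsGammaSet {V : Type*} (G : SimpleGraph V) (S : Finset V) : Prop :=
  IsMinimalDominating G S ∧ S.card = upperDominationNumber G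

/-- An `α`-set: an independent set of cardinality `α(G)`. -/
def IsAlphaSet {V : Type*} (G : SimpleGraph V) (S : Finset V) : Prop :=
  G.IsIndepSet (S : Set V) ∧ S.card = G.indepNum

/-- The corona of `T`: every vertex `v = inl v` gets one new neighbor `v' = inr v`, a leaf. -/
def corona {W : Type*} (T : SimpleGraph W) : SimpleGraph (W ⊕ W) :=
  SimpleGraph.fromRel fun a b =>
    match a, b with
    | Sum.inl u, Sum.inl v => T.Adj u v
    | Sum.inl u, Sum.inr v => u = v
    | _, _ => False

/-- A vertex is simplicial if its (open) neighborhood induces a complete subgraph. -/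
def IsSimplicial {V : Type*} (G : SimpleGraph V) (v : V) : Prop :=
  G.IsClique (G.neighborSet v)

/-- The clique graph: its vertices are the inclusion-maximal cliques of `G`, and two distinct ones
are adjacent if and only if they intersect. -/
def cliqueGraph {V : Type*} (G : SimpleGraph V) :
    SimpleGraph {K : Set V // Maximal G.IsClique K} where
  Adj K L := K ≠ L ∧ ((K : Set V) ∩ (L : Set V)).Nonempty
  symm := ⟨fun _ _ h => ⟨h.1.symm, by rw [Set.inter_comm]; exact h.2⟩⟩
  loopless := ⟨fun _ h => h.1 rfl⟩

/-- The vertices of the disjoint union of the line graphs of the coronas of the trees `T i`. -/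
abbrev LineVertex {q : ℕ} {m : Fin q → ℕ} (T : ∀ i, SimpleGraph (Fin (m i))) : Type :=
  Σ i, (corona (T i)).edgeSet

/-- The disjoint union of the line graphs of the coronas of the trees `T i`. -/
def lineUnion {q : ℕ} {m : Fin q → ℕ} (T : ∀ i, SimpleGraph (Fin (m i))) :
    SimpleGraph (LineVertex T) :=
  ⨆ i, (corona (T i)).lineGraph.map (Sigma.mk i)

/-- The graph obtained from `G` by contracting (identifying) each pair `x k, y k` to one vertex.
Here `SimpleGraph.map` along the quotient map discards loops. -/
def contractPairs {V κ : Type*} (G : SimpleGraph V) (x y : κ → V) :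
    SimpleGraph (Quotient (Relation.EqvGen.setoid fun a b => ∃ k, a = x k ∧ b = y k)) :=
  G.map (Quotient.mk _)

/-- Membership, up to isomorphism, of `G` in the family `𝓕`: there are `q ≥ 1` non-trivial trees
`T i` and `q - 1` pairs `x k, y k` of simplicial vertices of the line graphs `L i` of the coronas
of the `T i`, the two vertices of each pair in different line graphs and all `2 (q - 1)` vertices
distinct, such that `G` results from the disjoint union of the `L i` by contracting each pair, and
for `q ≥ 2` the clique graph of the result is a tree. For `q = 1` there are no pairs and the result
is `L 0` itself. -/
def InFamily {V : Type*} (G : SimpleGraph V) : Prop :=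
  ∃ (q : ℕ) (m : Fin q → ℕ) (T : ∀ i, SimpleGraph (Fin (m i)))
    (x y : Fin (q - 1) → LineVertex T),
    1 ≤ q ∧
    (∀ i, 2 ≤ m i ∧ (T i).IsTree) ∧
    (∀ k, IsSimplicial (corona (T (x k).1)).lineGraph (x k).2 ∧
      IsSimplicial (corona (T (y k).1)).lineGraph (y k).2 ∧ (x k).1 ≠ (y k).1) ∧
    Function.Injective (Sum.elim x y) ∧
    (2 ≤ q → (cliqueGraph (contractPairs (lineUnion T) x y)).IsTree) ∧
    Nonempty (G ≃g contractPairs (lineUnion T) x y)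

/-- `(A, B)` is a partition of the vertex set, of order `n`, with `|A| = (n - 1) / 2`,
`|B| = (n + 1) / 2`, `B` independent, and every vertex of `A` having exactly two neighbors
in `B`. -/
structure IsAssociatedPartition {V : Type*} [Fintype V] (G : SimpleGraph V) (A B : Finset V) :
    Prop where
  disjoint : Disjoint A B
  cover : ∀ v, v ∈ A ∨ v ∈ B
  card_A : 2 * A.card + 1 = Fintype.card V
  card_B : 2 * B.card = Fintype.card V + 1
  indep_B : G.IsIndepSet (B : Set V)
  two_neighbors : ∀ a ∈ A, (G.neighborSet a ∩ (B : Set V)).ncard = 2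

end Favaron

/-!
The graph `G` is the line graph of a forest with a perfect matching. The nodes of the forest are the
vertices of the trees `T i` and one pendant vertex for each pendant edge that is not contracted; its
edges are the tree edges, the pendant edges that are not contracted, and for each contracted pair
`u u'`, `v v'` an edge `u v`. The pendant edges and the contracted pairs form a perfect matching `B`.
The forest is acyclic because the vertices of `G` incident with a node of a tree form a maximal
clique that determines the node, which embeds the graph on these nodes into the clique graph
(`exists_isAcyclic_of_cliqueGraph`). For `q = 1`, when nothing is assumed about the clique graph, the
graph on these nodes is the tree `T 0` itself.

Acyclicity is used as the inequality `#X < #(X.biUnion E)` between the number of edges in a non-empty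
set `X` and the number of their ends (`IsForest`). It is also what bounds `Γ(G)`: each member `s` of a
minimal dominating set `S` has a private edge `f s`, one that meets no other member of `S`. Let `S₂`
consist of the members of `S` that meet another member. Then `S₂` and `f '' S₂` are `2 * #S₂` edges,
which cover more than `2 * #S₂` nodes unless `S₂` is empty, and the remaining members of `S` cover two
further nodes each. Hence `2 * #S` is at most the number `2 * #B` of all nodes, and in case of equality
`S` is a perfect matching (`IsForest.eq_of_isIrredundant`), of which a forest has only one
(`IsForest.perfectMatching_unique`). Independent sets are covered by the same argument, with `f s = s`.
Finally, a tree of order `n` has `n - 1` edges, and counting gives `2 * #B = |V(G)| + 1`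
(`card_model`). So `B` and its complement form an associated partition, and the independent set in any
associated partition has `#B` members, whence it is `B`.
-/

namespace Favaron

open Finset

/-! ### Forests as families of pairs of ends -/

/-- A forest given by its edges: `E x` is the set of the two ends of the edge `x`, and every
non-empty set of edges covers more nodes than it has edges. The last condition rules out cycles and
parallel edges, and it is the only way in which acyclicity is used. -/
structure IsForest {V N : Type*} [DecidableEq N] (E : V → Finset N) : Prop where
  card_ends : ∀ x, #(E x) = 2
  card_lt : ∀ X : Finset V, X.Nonempty → #X < #(X.biUnion E)

/-- In an acyclic graph, a non-empty set of edges has more ends than members. -/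
lemma card_lt_card_biUnion_of_isAcyclic {V N : Type*} [DecidableEq N] {H : SimpleGraph N}
    (hH : H.IsAcyclic) (E : V → Finset N) {X : Finset V} (hX : X.Nonempty)
    (hadj : ∀ x ∈ X, ∃ c d, H.Adj c d ∧ E x = {c, d}) (hinj : Set.InjOn E X) :
    #X < #(X.biUnion E) := by
  classical
  set U := X.biUnion E with hU
  have hUne : U.Nonempty := by
    obtain ⟨x, hx⟩ := hX
    obtain ⟨c, d, -, hE⟩ := hadj x hx
    exact ⟨c, mem_biUnion.2 ⟨x, hx, by simp [hE]⟩⟩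
  have : Nonempty (U : Set N) := hUne.to_subtype
  have : Nonempty (Sym2 (U : Set N)) := this.map fun c => s(c, c)
  have key : ∀ x ∈ X, ∃ e : Sym2 (U : Set N),
      e ∈ (H.induce (U : Set N)).edgeSet ∧ (e.map Subtype.val).toFinset = E x := by
    intro x hx
    obtain ⟨c, d, hcd, hE⟩ := hadj x hx
    have hc : c ∈ U := mem_biUnion.2 ⟨x, hx, by simp [hE]⟩
    have hd : d ∈ U := mem_biUnion.2 ⟨x, hx, by simp [hE]⟩
    exact ⟨s(⟨c, hc⟩, ⟨d, hd⟩), by simpa using hcd, by ext; simp [hE]⟩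
  choose! f hf1 hf2 using key
  -- The graph induced on the covered nodes extends to a tree on them.
  obtain ⟨F, hF, -, hT⟩ :=
    (SimpleGraph.connected_top (V := (U : Set N))).exists_isTree_le_of_le_of_isAcyclic
      le_top (hH.induce (U : Set N))
  have hcard := hT.card_edgeFinset
  have hle : #X ≤ #F.edgeFinset := by
    refine card_le_card_of_injOn f (fun x hx => ?_) (fun x hx y hy hxy => ?_)
    · simpa using SimpleGraph.edgeSet_mono hF (hf1 x hx)
    · exact hinj hx hy (by rw [← hf2 x hx, ← hf2 y hy, hxy])
  have : Fintype.card (U : Set N) = #U := by simp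
  omega

/-- A forest keeps its defining inequality when pendant edges are added: here a member `x` of the
family with only one end gets the new node `inr x` as its second end. -/
lemma IsForest.of_isAcyclic {V N : Type*} [DecidableEq V] [DecidableEq N] {H : SimpleGraph N}
    (hH : H.IsAcyclic) (E : V → Finset N) (h1 : ∀ x, (E x).Nonempty) (h2 : ∀ x, #(E x) ≤ 2)
    (hadj : ∀ x, ∀ c ∈ E x, ∀ d ∈ E x, c ≠ d → H.Adj c d)
    (hinj : ∀ x y, #(E x) = 2 → E x = E y → x = y) :
    IsForest (fun x => (E x).disjSum (if #(E x) = 1 then {x} else ∅)) where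
  card_ends x := by
    have := (h1 x).card_pos
    have := h2 x
    rw [card_disjSum]
    split_ifs <;> simp <;> omega
  card_lt X hX := by
    set E' : V → Finset (N ⊕ V) := fun x => (E x).disjSum (if #(E x) = 1 then {x} else ∅) with hE'
    set F := X.filter (fun x => #(E x) ≠ 1)
    set P := X.filter (fun x => #(E x) = 1)
    have hX' : #P + #F = #X := card_filter_add_card_filter_not _
    have hsub : (X.biUnion E).disjSum P ⊆ X.biUnion E' := by
      intro c hc
      rw [mem_disjSum] at hc
      rw [mem_biUnion]
      rcases hc with ⟨a, ha, rfl⟩ | ⟨a, ha, rfl⟩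
      · obtain ⟨x, hx, hax⟩ := mem_biUnion.1 ha
        exact ⟨x, hx, by simp [hE', hax]⟩
      · obtain ⟨ha, ha1⟩ := mem_filter.1 ha
        exact ⟨a, ha, by simp [hE', ha1]⟩
    have hle := card_le_card hsub
    rw [card_disjSum] at hle
    have hlt : #F < #(X.biUnion E) := by
      rcases F.eq_empty_or_nonempty with hF | hF
      · obtain ⟨x, hx⟩ := hX
        rw [hF, card_empty, card_pos]
        obtain ⟨c, hc⟩ := h1 x
        exact ⟨c, mem_biUnion.2 ⟨x, hx, hc⟩⟩
      · have two : ∀ x ∈ F, #(E x) = 2 := fun x hx => by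
          have := (mem_filter.1 hx).2
          have := (h1 x).card_pos
          have := h2 x
          omega
        refine (card_lt_card_biUnion_of_isAcyclic hH E hF (fun x hx => ?_)
          (fun x hx y _ h => hinj x y (two x hx) h)).trans_le
          (card_le_card (biUnion_subset_biUnion_of_subset_left _ (filter_subset _ _)))
        obtain ⟨c, d, hcd, hx'⟩ := card_eq_two.1 (two x hx)
        exact ⟨c, d, hadj x c (by simp [hx']) d (by simp [hx']) hcd, hx'⟩
    omega

/-! ### Perfect matchings and irredundant sets of edges in a forest -/

section Matching

variable {V N : Type*} [DecidableEq N] {E : V → Finset N}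

/-- A perfect matching of the graph whose edges are the sets `E x`: members of `B` are pairwise
disjoint and cover every end. -/
structure IsPerfectMatching (E : V → Finset N) (B : Finset V) : Prop where
  disjoint : ∀ a ∈ B, ∀ b ∈ B, a ≠ b → Disjoint (E a) (E b)
  cover : ∀ x, ∀ c ∈ E x, ∃ b ∈ B, c ∈ E b

lemma IsForest.not_disjoint_self (hE : IsForest E) (x : V) : ¬ Disjoint (E x) (E x) := by
  rw [disjoint_self_iff_empty]
  intro h
  simpa [h] using hE.card_ends x

lemma IsForest.card_biUnion (hE : IsForest E) {S : Finset V}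
    (hS : ∀ a ∈ S, ∀ b ∈ S, a ≠ b → Disjoint (E a) (E b)) : #(S.biUnion E) = 2 * #S := by
  rw [Finset.card_biUnion hS, sum_congr rfl fun x _ => hE.card_ends x]
  simp [mul_comm]

/-- A forest has at most one perfect matching: each node covered by the symmetric difference of two
of them lies in one edge of either, so that the symmetric difference has as many edges as nodes. -/
lemma IsForest.perfectMatching_unique [DecidableEq V] (hE : IsForest E) {S B : Finset V}
    (hS : IsPerfectMatching E S) (hB : IsPerfectMatching E B) (hcard : #S = #B) : S = B := by
  have hdisj : Disjoint (S \ B) (B \ S) := disjoint_left.2 fun x h h' => by grind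
  have h1 : #(S \ B) = #(B \ S) := card_sdiff_comm hcard
  rcases (S \ B ∪ B \ S).eq_empty_or_nonempty with h | h
  · ext x
    have := eq_empty_iff_forall_notMem.1 h x
    grind
  · have hlt := hE.card_lt _ h
    rw [card_union_of_disjoint hdisj] at hlt
    have hsub : (S \ B ∪ B \ S).biUnion E ⊆ (S \ B).biUnion E := by
      intro c hc
      obtain ⟨x, hx, hcx⟩ := mem_biUnion.1 hc
      rcases mem_union.1 hx with hx | hx
      · exact mem_biUnion.2 ⟨x, hx, hcx⟩
      · obtain ⟨s, hs, hcs⟩ := hS.cover x c hcx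
        obtain ⟨hxB, hxS⟩ := mem_sdiff.1 hx
        refine mem_biUnion.2 ⟨s, mem_sdiff.2 ⟨hs, fun hsB => ?_⟩, hcs⟩
        exact disjoint_left.1 (hB.disjoint s hsB x hxB (by rintro rfl; exact hxS hs)) hcs hcx
    have := card_le_card hsub
    rw [hE.card_biUnion fun a ha b hb =>
      hS.disjoint a (mem_sdiff.1 ha).1 b (mem_sdiff.1 hb).1] at this
    omega

/-- `S` is irredundant: each `s ∈ S` has a private edge `f`, one which it meets while no other
member of `S` does. Matchings and minimal edge-dominating sets have this property. -/
def IsIrredundant (E : V → Finset N) (S : Finset V) : Prop :=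
  ∀ s ∈ S, ∃ f, ¬ Disjoint (E s) (E f) ∧ ∀ u ∈ S, u ≠ s → Disjoint (E u) (E f)

/-- An irredundant set of edges of a forest with a perfect matching `B` has at most `#B` members,
and it is `B` in case of equality. Let `S₂` be the members of `S` that meet another member. Their
private edges lie outside `S`, so together with them they are `2 * #S₂` edges, which cover more than
`2 * #S₂` nodes unless `S₂ = ∅`; the `2 * #(S \ S₂)` ends of the other members are further nodes. -/
lemma IsForest.eq_of_isIrredundant [DecidableEq V] (hE : IsForest E) {S B : Finset V}
    (hB : IsPerfectMatching E B) (hS : IsIrredundant E S) (hcard : #B ≤ #S) : S = B := by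
  choose! f hf1 hf2 using hS
  have cover (X : Finset V) : X.biUnion E ⊆ B.biUnion E := fun c hc => by
    obtain ⟨x, -, hx⟩ := mem_biUnion.1 hc
    obtain ⟨b, hb, hcb⟩ := hB.cover x c hx
    exact mem_biUnion.2 ⟨b, hb, hcb⟩
  have hBc := hE.card_biUnion hB.disjoint
  set S₂ := S.filter (fun s => ∃ t ∈ S, t ≠ s ∧ ¬ Disjoint (E t) (E s)) with hS₂
  set S₁ := S.filter (fun s => ¬ ∃ t ∈ S, t ≠ s ∧ ¬ Disjoint (E t) (E s)) with hS₁
  have hS₁₂ : #S₂ + #S₁ = #S := card_filter_add_card_filter_not _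
  have hS₁c : #(S₁.biUnion E) = 2 * #S₁ := by
    refine hE.card_biUnion fun a ha b hb hab => ?_
    by_contra h
    exact (mem_filter.1 hb).2 ⟨a, (mem_filter.1 ha).1, hab, h⟩
  rcases S₂.eq_empty_or_nonempty with hemp | hne
  · have hdisj : ∀ a ∈ S, ∀ b ∈ S, a ≠ b → Disjoint (E a) (E b) := fun a ha b hb hab => by
      by_contra h
      exact eq_empty_iff_forall_notMem.1 hemp b (mem_filter.2 ⟨hb, a, ha, hab, h⟩)
    have hSc := hE.card_biUnion hdisj
    have heq : S.biUnion E = B.biUnion E := eq_of_subset_of_card_le (cover S) (by omega)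
    refine hE.perfectMatching_unique ⟨hdisj, fun x c hc => ?_⟩ hB (by rw [heq] at hSc; omega)
    obtain ⟨b, hb, hcb⟩ := hB.cover x c hc
    exact mem_biUnion.1 (heq ▸ mem_biUnion.2 ⟨b, hb, hcb⟩)
  · exfalso
    have hfS : ∀ s ∈ S₂, f s ∉ S := fun s hs h => by
      obtain ⟨hs, t, ht, hts, hd⟩ := mem_filter.1 hs
      by_cases hfs : f s = s
      · exact hd (hfs ▸ hf2 s hs t ht hts)
      · exact hE.not_disjoint_self _ (hf2 s hs _ h hfs)
    have hfinj : Set.InjOn f S₂ := fun s hs t ht hst => by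
      by_contra hne
      exact hf1 s (mem_filter.1 hs).1
        (hst ▸ hf2 t (mem_filter.1 ht).1 s (mem_filter.1 hs).1 hne)
    have hX : #(S₂ ∪ S₂.image f) = 2 * #S₂ := by
      rw [card_union_of_disjoint, card_image_of_injOn hfinj, two_mul]
      rw [disjoint_left]
      intro x hx hx'
      obtain ⟨s, hs, rfl⟩ := mem_image.1 hx'
      exact hfS s hs (mem_filter.1 hx).1
    have hlt := hE.card_lt (S₂ ∪ S₂.image f) (hne.mono subset_union_left)
    have hdis : Disjoint (S₁.biUnion E) ((S₂ ∪ S₂.image f).biUnion E) := by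
      rw [disjoint_biUnion_left]
      intro a ha
      rw [disjoint_biUnion_right]
      intro x hx
      obtain ⟨haS, ha'⟩ := mem_filter.1 ha
      rcases mem_union.1 hx with hx | hx
      · by_contra h
        refine ha' ⟨x, (mem_filter.1 hx).1, ?_, fun h' => h h'.symm⟩
        rintro rfl
        exact ha' (mem_filter.1 hx).2
      · obtain ⟨s, hs, rfl⟩ := mem_image.1 hx
        refine hf2 s (mem_filter.1 hs).1 a haS ?_
        rintro rfl
        exact ha' (mem_filter.1 hs).2
    have := card_le_card (union_subset (cover S₁) (cover (S₂ ∪ S₂.image f)))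
    rw [card_union_of_disjoint hdis] at this
    omega

end Matching

/-! ### Line graphs of forests with a perfect matching -/

section LineGraph

variable {V N : Type*} [DecidableEq N] {E : V → Finset N} {G : SimpleGraph V} {B S : Finset V}

/-- `G` is the line graph of the graph whose edges are the sets `E x`. -/
def IsLineGraphOf (G : SimpleGraph V) (E : V → Finset N) : Prop :=
  ∀ x y, G.Adj x y ↔ x ≠ y ∧ ¬ Disjoint (E x) (E y)

lemma IsLineGraphOf.isIndepSet_iff (hG : IsLineGraphOf G E) :
    G.IsIndepSet (S : Set V) ↔ ∀ a ∈ S, ∀ b ∈ S, a ≠ b → Disjoint (E a) (E b) := by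
  refine ⟨fun h a ha b hb hab => ?_, fun h a ha b hb hab => ?_⟩
  · by_contra hd
    exact h ha hb hab ((hG a b).2 ⟨hab, hd⟩)
  · exact fun hadj => ((hG a b).1 hadj).2 (h a ha b hb hab)

lemma IsLineGraphOf.eq_or_adj_iff (hG : IsLineGraphOf G E) (hE : IsForest E) (x y : V) :
    x = y ∨ G.Adj x y ↔ ¬ Disjoint (E x) (E y) := by
  rw [hG]
  by_cases h : x = y
  · simpa [h] using hE.not_disjoint_self y
  · simp [h]

lemma IsLineGraphOf.isIrredundant_of_isIndepSet (hG : IsLineGraphOf G E) (hE : IsForest E)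
    (hS : G.IsIndepSet (S : Set V)) : IsIrredundant E S := fun s hs =>
  ⟨s, hE.not_disjoint_self s, fun u hu hus => hG.isIndepSet_iff.1 hS u hu s hs hus⟩

lemma IsLineGraphOf.isIrredundant_of_isMinimalDominating [DecidableEq V] (hG : IsLineGraphOf G E)
    (hE : IsForest E) (hS : IsMinimalDominating G S) : IsIrredundant E S := fun s hs => by
  have hnot : ¬ IsDominating G (S.erase s) := fun h => by
    have := hS.2 h (erase_subset _ _) hs
    simp at this
  simp only [IsDominating, not_forall, not_exists, not_and, hG.eq_or_adj_iff hE, not_not] at hnot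
  obtain ⟨f, hf⟩ := hnot
  obtain ⟨u, hu, huf⟩ := hS.1 f
  rw [hG.eq_or_adj_iff hE] at huf
  have hus : u = s := by
    by_contra hne
    exact huf (hf u (mem_erase.2 ⟨hne, hu⟩))
  exact ⟨f, hus ▸ huf, fun u hu hne => hf u (mem_erase.2 ⟨hne, hu⟩)⟩

lemma IsLineGraphOf.isMinimalDominating (hG : IsLineGraphOf G E) (hE : IsForest E)
    (hB : IsPerfectMatching E B) : IsMinimalDominating G B := by
  refine ⟨fun v => ?_, fun S hS hSB b hb => ?_⟩
  · have : (E v).Nonempty := by rw [← card_pos, hE.card_ends]; norm_num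
    obtain ⟨c, hc⟩ := this
    obtain ⟨b, hb, hcb⟩ := hB.cover v c hc
    exact ⟨b, hb, (hG.eq_or_adj_iff hE b v).2 (not_disjoint_iff.2 ⟨c, hcb, hc⟩)⟩
  · obtain ⟨u, hu, hub⟩ := hS b
    rw [hG.eq_or_adj_iff hE] at hub
    by_contra hbS
    exact hub (hB.disjoint u (hSB hu) b hb (by rintro rfl; exact hbS hu))

variable [DecidableEq V]

lemma IsLineGraphOf.isAlphaSet_iff [Finite V] (hG : IsLineGraphOf G E) (hE : IsForest E)
    (hB : IsPerfectMatching E B) : IsAlphaSet G S ↔ S = B := by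
  have hBi : G.IsIndepSet (B : Set V) := hG.isIndepSet_iff.2 hB.disjoint
  have huniq : ∀ S : Finset V, G.IsIndepSet (S : Set V) → #B ≤ #S → S = B := fun S hS =>
    hE.eq_of_isIrredundant hB (hG.isIrredundant_of_isIndepSet hE hS)
  refine ⟨fun h => huniq S h.1 (h.2 ▸ hBi.card_le_indepNum), ?_⟩
  rintro rfl
  refine ⟨hBi, ?_⟩
  obtain ⟨T, hT, hTc⟩ := G.exists_isNIndepSet_indepNum
  rw [← hTc, huniq T hT (hTc ▸ hBi.card_le_indepNum)]

lemma IsLineGraphOf.isGammaSet_iff (hG : IsLineGraphOf G E) (hE : IsForest E)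
    (hB : IsPerfectMatching E B) : IsGammaSet G S ↔ S = B := by
  have hBm := hG.isMinimalDominating hE hB
  have huniq : ∀ S : Finset V, IsMinimalDominating G S → #B ≤ #S → S = B := fun S hS =>
    hE.eq_of_isIrredundant hB (hG.isIrredundant_of_isMinimalDominating hE hS)
  have hΓ : upperDominationNumber G = #B := by
    refine IsGreatest.csSup_eq ⟨⟨B, hBm, rfl⟩, ?_⟩
    rintro k ⟨T, hT, rfl⟩
    by_contra! h
    rw [huniq T hT h.le] at h
    exact h.false
  refine ⟨fun h => huniq S h.1 (by rw [h.2, hΓ]), ?_⟩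
  rintro rfl
  exact ⟨hBm, hΓ.symm⟩

/-- Each edge outside a perfect matching of a forest meets exactly two edges of the matching. -/
lemma IsLineGraphOf.ncard_neighborSet_inter (hG : IsLineGraphOf G E) (hE : IsForest E)
    (hB : IsPerfectMatching E B) {a : V} (ha : a ∉ B) :
    (G.neighborSet a ∩ (B : Set V)).ncard = 2 := by
  obtain ⟨c, d, hcd, hEa⟩ := card_eq_two.1 (hE.card_ends a)
  obtain ⟨b, hb, hcb⟩ := hB.cover a c (by simp [hEa])
  obtain ⟨b', hb', hdb'⟩ := hB.cover a d (by simp [hEa])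
  have hbb' : b ≠ b' := by
    rintro rfl
    -- Otherwise `a` and `b` are parallel edges.
    have hlt := hE.card_lt {a, b} (by simp)
    have hEb : {c, d} = E b := eq_of_subset_of_card_le
      (by simp [insert_subset_iff, hcb, hdb']) (by rw [hE.card_ends, card_pair hcd])
    rw [card_pair (by rintro rfl; exact ha hb)] at hlt
    simp [hEa, ← hEb, card_pair hcd] at hlt
  rw [Set.ncard_eq_two]
  refine ⟨b, b', hbb', ?_⟩
  ext z
  simp only [Set.mem_inter_iff, SimpleGraph.mem_neighborSet, mem_coe, Set.mem_insert_iff,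
    Set.mem_singleton_iff, hG a z]
  constructor
  · rintro ⟨⟨-, hd⟩, hz⟩
    obtain ⟨x, hx, hxz⟩ := not_disjoint_iff.1 hd
    rw [hEa, mem_insert, mem_singleton] at hx
    rcases hx with rfl | rfl
    · left
      by_contra hne
      exact disjoint_left.1 (hB.disjoint z hz b hb hne) hxz hcb
    · right
      by_contra hne
      exact disjoint_left.1 (hB.disjoint z hz b' hb' hne) hxz hdb'
  · rintro (rfl | rfl)
    · exact ⟨⟨by rintro rfl; exact ha hb, not_disjoint_iff.2 ⟨c, by simp [hEa], hcb⟩⟩, hb⟩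
    · exact ⟨⟨by rintro rfl; exact ha hb', not_disjoint_iff.2 ⟨d, by simp [hEa], hdb'⟩⟩, hb'⟩

/-- The conclusion for the line graph of a forest with a perfect matching `B` that makes up just over
half of its edges, as it does when the forest is a tree. -/
theorem IsLineGraphOf.associatedPartition [Fintype V] (hG : IsLineGraphOf G E) (hE : IsForest E)
    (hB : IsPerfectMatching E B) (hcard : 2 * #B = Fintype.card V + 1) :
    (∃ A B : Finset V, IsAssociatedPartition G A B) ∧
    ∀ A B : Finset V, IsAssociatedPartition G A B →
      (∀ S : Finset V, IsAlphaSet G S ↔ S = B) ∧ (∀ S : Finset V, IsGammaSet G S ↔ S = B) := by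
  constructor
  · refine ⟨Bᶜ, B, disjoint_compl_left, fun v => ?_, ?_, hcard, hG.isIndepSet_iff.2 hB.disjoint,
      fun a ha => hG.ncard_neighborSet_inter hE hB (mem_compl.1 ha)⟩
    · rw [mem_compl]
      exact (em _).symm
    · have := card_compl_add_card B
      omega
  · intro A B' h
    have hB' : B' = B := hE.eq_of_isIrredundant hB
      (hG.isIrredundant_of_isIndepSet hE h.indep_B) (by have := h.card_B; omega)
    subst hB'
    exact ⟨fun S => hG.isAlphaSet_iff hE hB, fun S => hG.isGammaSet_iff hE hB⟩

end LineGraph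

/-! ### Coronas and their simplicial edges -/

section Corona

variable {W : Type*} {T : SimpleGraph W}

lemma corona_adj_inl_inl {u v : W} : (corona T).Adj (Sum.inl u) (Sum.inl v) ↔ T.Adj u v := by
  simp only [corona, SimpleGraph.fromRel_adj]
  refine ⟨fun h => h.2.elim id fun h => h.symm, fun h => ⟨fun h' => h.ne (by simpa using h'), .inl h⟩⟩

lemma corona_adj_inl_inr {u v : W} : (corona T).Adj (Sum.inl u) (Sum.inr v) ↔ u = v := by
  simp [corona, SimpleGraph.fromRel_adj]

lemma not_corona_adj_inr_inr {u v : W} : ¬ (corona T).Adj (Sum.inr u) (Sum.inr v) := by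
  simp [corona, SimpleGraph.fromRel_adj]

lemma mem_edgeSet_corona {e : Sym2 (W ⊕ W)} : e ∈ (corona T).edgeSet ↔
    (∃ e' ∈ T.edgeSet, e = e'.map Sum.inl) ∨ ∃ v, e = s(Sum.inl v, Sum.inr v) := by
  constructor
  · induction e with | _ a b
    rw [SimpleGraph.mem_edgeSet]
    rcases a with a | a <;> rcases b with b | b <;> intro h
    · exact .inl ⟨s(a, b), corona_adj_inl_inl.1 h, by simp⟩
    · exact .inr ⟨a, by rw [corona_adj_inl_inr.1 h]⟩
    · exact .inr ⟨b, by rw [corona_adj_inl_inr.1 h.symm, Sym2.eq_swap]⟩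
    · exact (not_corona_adj_inr_inr h).elim
  · rintro (⟨e', he', rfl⟩ | ⟨v, rfl⟩)
    · induction e' with | _ a b
      simpa [corona_adj_inl_inl] using he'
    · simp [corona_adj_inl_inr]

/-- A tree edge `uv` is adjacent in the line graph to the two disjoint pendant edges at `u` and `v`,
so only pendant edges are simplicial. -/
lemma exists_eq_of_isSimplicial {e : (corona T).edgeSet} (he : IsSimplicial (corona T).lineGraph e) :
    ∃ v, (e : Sym2 (W ⊕ W)) = s(Sum.inl v, Sum.inr v) := by
  refine (mem_edgeSet_corona.1 e.2).resolve_left ?_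
  rintro ⟨e', he', hee'⟩
  induction e' with | _ u v
  have huv : u ≠ v := SimpleGraph.Adj.ne he'
  have hp : ∀ w ∈ s(u, v), (⟨s(Sum.inl w, Sum.inr w), mem_edgeSet_corona.2 (.inr ⟨w, rfl⟩)⟩ :
      (corona T).edgeSet) ∈ (corona T).lineGraph.neighborSet e := fun w hw => by
    rw [SimpleGraph.mem_neighborSet, SimpleGraph.lineGraph_adj_iff_exists]
    refine ⟨fun h => ?_, Sum.inl w, ?_, by simp⟩
    · have := congrArg Subtype.val h
      rw [hee'] at this
      simp at this
    · rw [hee']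
      simpa using hw
  have hne : (⟨s(Sum.inl u, Sum.inr u), mem_edgeSet_corona.2 (.inr ⟨u, rfl⟩)⟩ :
      (corona T).edgeSet) ≠ ⟨s(Sum.inl v, Sum.inr v), mem_edgeSet_corona.2 (.inr ⟨v, rfl⟩)⟩ :=
    fun h => by simp [huv] at h
  have hadj := he (hp u (by simp)) (hp v (by simp)) hne
  rw [SimpleGraph.lineGraph_adj_iff_exists] at hadj
  obtain ⟨-, w, hw1, hw2⟩ := hadj
  rcases w with w | w <;> simp at hw1 hw2 <;> exact huv (hw1.symm.trans hw2)

end Corona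

/-! ### Identifying pairs of points -/

section Merge

variable {κ C : Type*} {x y : κ → C}

open Classical in
/-- The retraction of `C` that sends `y k` to `x k` for each `k`. -/
noncomputable def merge (x y : κ → C) (c : C) : C :=
  if h : ∃ k, y k = c then x h.choose else c

lemma merge_of_notMem {c : C} (hc : c ∉ Set.range y) : merge x y c = c :=
  dif_neg hc

variable (hxy : Function.Injective (Sum.elim x y))
include hxy

lemma merge_apply (k : κ) : merge x y (y k) = x k := by
  have h : ∃ j, y j = y k := ⟨k, rfl⟩
  rw [merge, dif_pos h, (hxy.comp Sum.inr_injective : Function.Injective y) h.choose_spec]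

lemma left_notMem_range (k : κ) : x k ∉ Set.range y := by
  rintro ⟨j, hj⟩
  simpa using @hxy (Sum.inl k) (Sum.inr j) hj.symm

lemma merge_notMem (c : C) : merge x y c ∉ Set.range y := by
  by_cases hc : c ∈ Set.range y
  · obtain ⟨k, rfl⟩ := hc
    rw [merge_apply hxy]
    exact left_notMem_range hxy k
  · rwa [merge_of_notMem hc]

lemma eq_or_of_merge_eq {c d : C} (h : merge x y c = merge x y d) :
    c = d ∨ ∃ k, (c = x k ∧ d = y k) ∨ (c = y k ∧ d = x k) := by
  by_cases hc : c ∈ Set.range y <;> by_cases hd : d ∈ Set.range y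
  · obtain ⟨k, rfl⟩ := hc
    obtain ⟨j, rfl⟩ := hd
    rw [merge_apply hxy, merge_apply hxy] at h
    left
    rw [(hxy.comp Sum.inl_injective) h]
  · obtain ⟨k, rfl⟩ := hc
    rw [merge_apply hxy, merge_of_notMem hd] at h
    exact .inr ⟨k, .inr ⟨rfl, h.symm⟩⟩
  · obtain ⟨k, rfl⟩ := hd
    rw [merge_apply hxy, merge_of_notMem hc] at h
    exact .inr ⟨k, .inl ⟨h, rfl⟩⟩
  · rw [merge_of_notMem hc, merge_of_notMem hd] at h
    exact .inl h

end Merge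

/-! ### The contracted graph as a line graph -/

section Model

variable {q : ℕ} {m : Fin q → ℕ}

/-- The vertices of the disjoint union of the trees. -/
abbrev Node {q : ℕ} (m : Fin q → ℕ) : Type := Σ i, Fin (m i)

/-- The tree edges and the pendant edges of the coronas, as vertices of the line graphs. -/
def lineVertexOf (T : ∀ i, SimpleGraph (Fin (m i))) :
    (Σ i, (T i).edgeSet) ⊕ Node m → LineVertex T
  | Sum.inl e => ⟨e.1, e.2.1.map Sum.inl, mem_edgeSet_corona.2 (.inl ⟨_, e.2.2, rfl⟩)⟩
  | Sum.inr c => ⟨c.1, s(Sum.inl c.2, Sum.inr c.2), mem_edgeSet_corona.2 (.inr ⟨_, rfl⟩)⟩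

lemma lineVertexOf_bijective (T : ∀ i, SimpleGraph (Fin (m i))) :
    Function.Bijective (lineVertexOf T) := by
  constructor
  · rintro (⟨i, e, he⟩ | ⟨i, v⟩) (⟨j, f, hf⟩ | ⟨j, w⟩) h <;>
      obtain rfl : i = j := congrArg Sigma.fst h <;>
      simp only [lineVertexOf, Sigma.mk.injEq, heq_eq_eq, true_and, Subtype.mk.injEq] at h
    · obtain rfl := Sym2.map.injective Sum.inl_injective h
      rfl
    · induction e with | _ a b
      simp at h
    · induction f with | _ a b
      simp at h
    · simp at h
      rw [h]
  · rintro ⟨i, e, he⟩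
    rcases mem_edgeSet_corona.1 he with ⟨e', he', rfl⟩ | ⟨v, rfl⟩
    · exact ⟨Sum.inl ⟨i, e', he'⟩, rfl⟩
    · exact ⟨Sum.inr ⟨i, v⟩, rfl⟩

/-- The node `c` is an end of the edge `a` of a corona. -/
def Inc {T : ∀ i, SimpleGraph (Fin (m i))} (a : LineVertex T) (c : Node m) : Prop :=
  ∃ v, c = ⟨a.1, v⟩ ∧ Sum.inl v ∈ a.2.1

variable {T : ∀ i, SimpleGraph (Fin (m i))}

/-- Two edges of a corona never share a pendant vertex, so adjacency is witnessed by nodes. -/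
lemma lineUnion_adj {a b : LineVertex T} :
    (lineUnion T).Adj a b ↔ a ≠ b ∧ ∃ c, Inc a c ∧ Inc b c := by
  simp only [lineUnion, SimpleGraph.iSup_adj, SimpleGraph.map_adj',
    SimpleGraph.lineGraph_adj_iff_exists]
  constructor
  · rintro ⟨i, hne, e, f, ⟨hef, w, hwe, hwf⟩, rfl, rfl⟩
    refine ⟨hne, ?_⟩
    rcases w with w | w
    · exact ⟨⟨i, w⟩, ⟨w, rfl, hwe⟩, ⟨w, rfl, hwf⟩⟩
    · have key : ∀ g : (corona (T i)).edgeSet, Sum.inr w ∈ g.1 →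
          g.1 = s(Sum.inl w, Sum.inr w) := fun g hg => by
        rcases mem_edgeSet_corona.1 g.2 with ⟨g', -, h⟩ | ⟨v, h⟩
        · rw [h, Sym2.mem_map] at hg
          simp at hg
        · rw [h] at hg ⊢
          simp at hg
          rw [hg]
      exact (hef (Subtype.ext ((key e hwe).trans (key f hwf).symm))).elim
  · rintro ⟨hne, c, ⟨v, rfl, hv⟩, w, hw, hw'⟩
    obtain ⟨i, e⟩ := a
    obtain ⟨j, f⟩ := b
    obtain rfl : i = j := congrArg Sigma.fst hw
    simp only [Sigma.mk.injEq, heq_eq_eq, true_and] at hw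
    subst hw
    exact ⟨i, hne, e, f, ⟨fun h => hne (by rw [h]), Sum.inl v, hv, hw'⟩, rfl, rfl⟩

variable {κ : Type*} (T) in
/-- The vertices of the contracted graph: the tree edges and, for each pendant edge, one
representative of its class. The representative is given by the node of the pendant edge, the pair
of nodes `x k`, `y k` being represented by `x k`. -/
abbrev Model (y : κ → Node m) : Type := (Σ i, (T i).edgeSet) ⊕ {c : Node m // c ∉ Set.range y}

variable {κ : Type*} {x y : κ → Node m}

open Classical in
/-- The nodes at which a vertex of the contracted graph is incident: the two ends of a tree edge, the
nodes of the pendant edges that were contracted to one vertex. -/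
noncomputable def ends (x y : κ → Node m) : Model T y → Finset (Node m)
  | Sum.inl e => e.2.1.toFinset.map (Function.Embedding.sigmaMk e.1)
  | Sum.inr c => univ.filter fun d => merge x y d = c

@[simp] lemma mem_ends_inl {e : Σ i, (T i).edgeSet} {c : Node m} :
    c ∈ ends (T := T) x y (Sum.inl e) ↔ ∃ v ∈ e.2.1, ⟨e.1, v⟩ = c := by
  simp [ends]

@[simp] lemma mem_ends_inr {b : {c : Node m // c ∉ Set.range y}} {c : Node m} :
    c ∈ ends (T := T) x y (Sum.inr b) ↔ merge x y c = b := by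
  simp [ends]

lemma card_ends_inl (e : Σ i, (T i).edgeSet) : #(ends x y (Sum.inl e : Model T y)) = 2 := by
  rw [ends, card_map, Sym2.card_toFinset_of_not_isDiag]
  exact (T e.1).not_isDiag_of_mem_edgeSet e.2.2

lemma mem_ends_inr_self (b : {c : Node m // c ∉ Set.range y}) :
    b.1 ∈ ends (T := T) x y (Sum.inr b) := by
  rw [mem_ends_inr, merge_of_notMem b.2]

lemma ends_nonempty (z : Model T y) : (ends x y z).Nonempty := by
  rcases z with e | b
  · rw [← card_pos, card_ends_inl]
    norm_num
  · exact ⟨b.1, mem_ends_inr_self b⟩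

variable (hxy : Function.Injective (Sum.elim x y)) (hne : ∀ k, (x k).1 ≠ (y k).1)
include hxy

lemma card_ends_le (z : Model T y) : #(ends x y z) ≤ 2 := by
  classical
  rcases z with e | ⟨b, hb⟩
  · exact (card_ends_inl e).le
  · by_cases h : ∃ k, b = x k
    · obtain ⟨k, rfl⟩ := h
      refine (card_le_card (t := {x k, y k}) fun d hd => ?_).trans card_le_two
      rw [mem_ends_inr] at hd
      rw [mem_insert, mem_singleton]
      by_cases hd' : d ∈ Set.range y
      · obtain ⟨j, rfl⟩ := hd'
        rw [merge_apply hxy] at hd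
        right
        rw [(hxy.comp Sum.inl_injective) hd]
      · rw [merge_of_notMem hd'] at hd
        exact .inl hd
    · refine (card_le_card (t := {b}) fun d hd => ?_).trans (by simp)
      rw [mem_ends_inr] at hd
      rw [mem_singleton]
      by_cases hd' : d ∈ Set.range y
      · obtain ⟨j, rfl⟩ := hd'
        rw [merge_apply hxy] at hd
        exact (h ⟨j, hd.symm⟩).elim
      · rwa [merge_of_notMem hd'] at hd

include hne in
/-- Contracted pendant edges come from different trees. -/
lemma eq_of_mem_ends_inr {b : {c : Node m // c ∉ Set.range y}} {c d : Node m}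
    (hc : c ∈ ends (T := T) x y (Sum.inr b)) (hd : d ∈ ends (T := T) x y (Sum.inr b))
    (h : c.1 = d.1) : c = d := by
  rw [mem_ends_inr] at hc hd
  rcases eq_or_of_merge_eq hxy (hc.trans hd.symm) with h' | ⟨k, ⟨rfl, rfl⟩ | ⟨rfl, rfl⟩⟩
  · exact h'
  · exact (hne k h).elim
  · exact (hne k h.symm).elim

omit hxy in
lemma fst_eq_of_mem_ends_inl {e : Σ i, (T i).edgeSet} {c : Node m}
    (hc : c ∈ ends (T := T) x y (Sum.inl e)) : c.1 = e.1 := by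
  obtain ⟨v, -, rfl⟩ := mem_ends_inl.1 hc
  rfl

include hne in
lemma ends_injective : Function.Injective (ends (T := T) x y) := by
  have aux : ∀ (e : Σ i, (T i).edgeSet) (b : {c : Node m // c ∉ Set.range y}),
      ends (T := T) x y (Sum.inl e) ≠ ends (T := T) x y (Sum.inr b) := fun e b h => by
    obtain ⟨c, d, hcd, h2⟩ := card_eq_two.1 (card_ends_inl (x := x) (y := y) e)
    have hc : c ∈ ends (T := T) x y (Sum.inl e) := by simp [h2]
    have hd : d ∈ ends (T := T) x y (Sum.inl e) := by simp [h2]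
    exact hcd (eq_of_mem_ends_inr hxy hne (h ▸ hc) (h ▸ hd)
      ((fst_eq_of_mem_ends_inl hc).trans (fst_eq_of_mem_ends_inl hd).symm))
  rintro (⟨i, e, he⟩ | b) (⟨j, f, hf⟩ | b') h
  · obtain ⟨c, hc⟩ := ends_nonempty (x := x) (Sum.inl ⟨i, e, he⟩ : Model T y)
    obtain rfl : i = j := (fst_eq_of_mem_ends_inl hc).symm.trans (fst_eq_of_mem_ends_inl (h ▸ hc))
    have hef : e = f := by
      ext v
      have := congrArg (⟨i, v⟩ ∈ ·) h
      simpa using this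
    subst hef
    rfl
  · exact (aux _ _ h).elim
  · exact (aux _ _ h.symm).elim
  · have := mem_ends_inr_self (T := T) (x := x) b
    rw [h, mem_ends_inr, merge_of_notMem b.2] at this
    rw [Subtype.ext this]

omit hxy in
lemma inc_lineVertexOf_inl {e : Σ i, (T i).edgeSet} {c : Node m} :
    Inc (lineVertexOf T (Sum.inl e)) c ↔ c ∈ ends (T := T) x y (Sum.inl e) := by
  rw [mem_ends_inl]
  constructor
  · rintro ⟨v, rfl, hv⟩
    obtain ⟨w, hw, hwv⟩ := Sym2.mem_map.1 hv
    exact ⟨w, hw, by rw [Sum.inl_injective hwv]; rfl⟩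
  · rintro ⟨v, hv, rfl⟩
    exact ⟨v, rfl, Sym2.mem_map.2 ⟨v, hv, rfl⟩⟩

omit hxy in
lemma inc_lineVertexOf_inr {c d : Node m} : Inc (lineVertexOf T (Sum.inr d)) c ↔ c = d := by
  constructor
  · rintro ⟨v, rfl, hv⟩
    rcases Sym2.mem_iff.1 hv with h | h
    · rw [Sum.inl_injective h]
      rfl
    · cases h
  · rintro rfl
    exact ⟨c.2, rfl, Sym2.mem_mk_left _ _⟩

/-- The contraction map, from the vertices of the disjoint union of the line graphs. -/
noncomputable def toModel (a : LineVertex T) : Model T y :=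
  Sum.map id (fun c => ⟨merge x y c, merge_notMem hxy c⟩)
    ((Equiv.ofBijective _ (lineVertexOf_bijective T)).symm a)

lemma toModel_lineVertexOf (s : (Σ i, (T i).edgeSet) ⊕ Node m) :
    toModel hxy (lineVertexOf T s) =
      Sum.map id (fun c => ⟨merge x y c, merge_notMem hxy c⟩) s := by
  have := (Equiv.ofBijective _ (lineVertexOf_bijective T)).symm_apply_apply s
  rw [toModel]
  exact congrArg _ this

lemma mem_ends_iff {z : Model T y} {c : Node m} :
    c ∈ ends x y z ↔ ∃ a, toModel hxy a = z ∧ Inc a c := by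
  constructor
  · intro hc
    rcases z with e | b
    · exact ⟨lineVertexOf T (Sum.inl e), toModel_lineVertexOf hxy _, inc_lineVertexOf_inl.2 hc⟩
    · refine ⟨lineVertexOf T (Sum.inr c), ?_, inc_lineVertexOf_inr.2 rfl⟩
      rw [toModel_lineVertexOf]
      exact congrArg Sum.inr (Subtype.ext (mem_ends_inr.1 hc))
  · rintro ⟨a, rfl, hac⟩
    obtain ⟨s, rfl⟩ := (lineVertexOf_bijective T).2 a
    rw [toModel_lineVertexOf]
    rcases s with e | d
    · exact inc_lineVertexOf_inl.1 hac
    · rw [inc_lineVertexOf_inr] at hac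
      subst hac
      exact mem_ends_inr.2 rfl

variable (T) in
/-- The vertices of the contracted graph, in terms of tree edges and representative nodes. -/
noncomputable def quotientEquiv {x' y' : κ → LineVertex T}
    (hx : ∀ k, x' k = lineVertexOf T (Sum.inr (x k)))
    (hy : ∀ k, y' k = lineVertexOf T (Sum.inr (y k))) :
    Quotient (Relation.EqvGen.setoid fun a b => ∃ k, a = x' k ∧ b = y' k) ≃ Model T y where
  toFun := Quotient.lift (toModel hxy) fun a b h => by
    induction h with
    | rel a b h =>
      obtain ⟨k, rfl, rfl⟩ := h
      rw [hx, hy, toModel_lineVertexOf, toModel_lineVertexOf]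
      simp [merge_apply hxy, merge_of_notMem (left_notMem_range hxy k)]
    | refl => rfl
    | symm _ _ _ h => exact h.symm
    | trans _ _ _ _ _ h h' => exact h.trans h'
  invFun z := Quotient.mk _ (lineVertexOf T (Sum.map id Subtype.val z))
  left_inv := by
    intro a
    induction a using Quotient.inductionOn with | _ a
    obtain ⟨s, rfl⟩ := (lineVertexOf_bijective T).2 a
    simp only [Quotient.lift_mk, toModel_lineVertexOf]
    rcases s with e | c
    · rfl
    · by_cases hc : c ∈ Set.range y
      · obtain ⟨k, rfl⟩ := hc
        refine Quotient.sound (Relation.EqvGen.rel _ _ ⟨k, ?_, (hy k).symm⟩)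
        simp [hx, merge_apply hxy]
      · simp [merge_of_notMem hc]
  right_inv := by
    rintro (e | ⟨c, hc⟩)
    · simp [toModel_lineVertexOf]
    · simp [toModel_lineVertexOf, merge_of_notMem hc]

lemma contractPairs_adj {x' y' : κ → LineVertex T}
    (hx : ∀ k, x' k = lineVertexOf T (Sum.inr (x k)))
    (hy : ∀ k, y' k = lineVertexOf T (Sum.inr (y k))) :
    IsLineGraphOf (contractPairs (lineUnion T) x' y')
      (fun z => ends x y (quotientEquiv T hxy hx hy z)) := by
  intro z w
  have hq : ∀ a, quotientEquiv T hxy hx hy (Quotient.mk _ a) = toModel hxy a := fun _ => rfl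
  rw [contractPairs, SimpleGraph.map_adj', not_disjoint_iff]
  refine and_congr_right fun hzw => ?_
  constructor
  · rintro ⟨a, b, hab, rfl, rfl⟩
    obtain ⟨-, c, hac, hbc⟩ := lineUnion_adj.1 hab
    exact ⟨c, (mem_ends_iff hxy).2 ⟨a, rfl, hac⟩, (mem_ends_iff hxy).2 ⟨b, rfl, hbc⟩⟩
  · rintro ⟨c, hz, hw⟩
    obtain ⟨a, ha, hac⟩ := (mem_ends_iff hxy).1 hz
    obtain ⟨b, hb, hbc⟩ := (mem_ends_iff hxy).1 hw
    rw [← hq, EmbeddingLike.apply_eq_iff_eq] at ha hb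
    refine ⟨a, b, lineUnion_adj.2 ⟨?_, c, hac, hbc⟩, ha, hb⟩
    rintro rfl
    exact hzw (ha.symm.trans hb)

end Model

/-! ### Acyclicity, counting, and the family -/

section Assembly

variable {q : ℕ} {m : Fin q → ℕ} {T : ∀ i, SimpleGraph (Fin (m i))} {κ : Type*}
  {x y : κ → Node m}

/-- For a single tree and no contraction, the nodes of a common vertex are adjacent in the tree. -/
lemma exists_isAcyclic_of_subsingleton [Subsingleton (Fin q)] [IsEmpty κ]
    (hT : ∀ i, (T i).IsTree) : ∃ H : SimpleGraph (Node m), H.IsAcyclic ∧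
      ∀ z : Model T y, ∀ c ∈ ends x y z, ∀ d ∈ ends x y z, c ≠ d → H.Adj c d := by
  classical
  rcases isEmpty_or_nonempty (Fin q) with h | ⟨⟨i₀⟩⟩
  · exact ⟨⊥, SimpleGraph.isAcyclic_bot, fun z c => (h.false c.1).elim⟩
  let f : Node m → Fin (m i₀) := fun c => (Subsingleton.elim c.1 i₀) ▸ c.2
  have hf : ∀ v, f ⟨i₀, v⟩ = v := fun v => rfl
  have hinj : Function.Injective f := by
    rintro ⟨i, v⟩ ⟨j, w⟩ h
    obtain rfl := Subsingleton.elim i i₀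
    obtain rfl := Subsingleton.elim i j
    rw [hf, hf] at h
    rw [h]
  refine ⟨(T i₀).comap f, (hT i₀).isAcyclic.of_comap ⟨f, hinj⟩, ?_⟩
  rintro (⟨i, e, he⟩ | b) c hc d hd hcd
  · obtain rfl := Subsingleton.elim i i₀
    obtain ⟨v, hv, rfl⟩ := mem_ends_inl.1 hc
    obtain ⟨w, hw, rfl⟩ := mem_ends_inl.1 hd
    rw [SimpleGraph.comap_adj, hf, hf]
    have hvw : v ≠ w := fun h => hcd (by rw [h])
    rwa [← SimpleGraph.mem_edgeSet, ← (Sym2.mem_and_mem_iff hvw).1 ⟨hv, hw⟩]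
  · have hy : ∀ c : Node m, c ∉ Set.range y := fun c ⟨k, _⟩ => isEmptyElim k
    rw [mem_ends_inr, merge_of_notMem (hy _)] at hc hd
    exact (hcd (hc.trans hd.symm)).elim

/-- The vertices incident with a node `c` form a maximal clique, and this clique determines `c`.
Hence, if the clique graph is acyclic, so is the graph on the nodes in which two nodes are adjacent
if they are incident with a common vertex. -/
lemma exists_isAcyclic_of_cliqueGraph {V : Type*} {G : SimpleGraph V} (Φ : V ≃ Model T y)
    (hxy : Function.Injective (Sum.elim x y)) (hne : ∀ k, (x k).1 ≠ (y k).1)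
    (hT : ∀ i, 2 ≤ m i ∧ (T i).IsTree) (hG : IsLineGraphOf G (fun v => ends x y (Φ v)))
    (hac : (cliqueGraph G).IsAcyclic) : ∃ H : SimpleGraph (Node m), H.IsAcyclic ∧
      ∀ z : Model T y, ∀ c ∈ ends x y z, ∀ d ∈ ends x y z, c ≠ d → H.Adj c d := by
  have hp : ∀ c : Node m, ∃ b, c ∈ ends (T := T) x y (Sum.inr b) := fun c =>
    ⟨⟨_, merge_notMem hxy c⟩, mem_ends_inr.2 rfl⟩
  have ht : ∀ c : Node m, ∃ e, c ∈ ends (T := T) x y (Sum.inl e) := fun ⟨i, v⟩ => by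
    have : Nontrivial (Fin (m i)) := Fin.nontrivial_iff_two_le.2 (hT i).1
    obtain ⟨w, hw⟩ := (hT i).2.connected.preconnected.exists_adj_of_nontrivial v
    exact ⟨⟨i, s(v, w), hw⟩, mem_ends_inl.2 ⟨v, by simp, rfl⟩⟩
  have hmax : ∀ c : Node m, Maximal G.IsClique {v | c ∈ ends x y (Φ v)} := fun c => by
    refine ⟨fun v hv w hw hvw => (hG v w).2 ⟨hvw, not_disjoint_iff.2 ⟨c, hv, hw⟩⟩, ?_⟩
    intro s hs hle v hv
    by_contra hcv
    have meet : ∀ z : Model T y, c ∈ ends x y z → ∃ d ∈ ends x y (Φ v), d ∈ ends x y z := by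
      intro z hz
      have hz' : Φ.symm z ∈ s := hle (by simpa using hz)
      have hvz : v ≠ Φ.symm z := by
        rintro rfl
        exact hcv (by simpa using hz)
      obtain ⟨d, hd, hd'⟩ := not_disjoint_iff.1 ((hG _ _).1 (hs hv hz' hvz)).2
      exact ⟨d, hd, by simpa using hd'⟩
    obtain ⟨b, hb⟩ := hp c
    obtain ⟨e, he⟩ := ht c
    obtain ⟨d, hd, hdb⟩ := meet _ hb
    obtain ⟨d', hd', hde⟩ := meet _ he
    -- `v` meets the tree of `c` in `d'` and another tree in `d`, so it is a contracted pair.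
    have h1 : d.1 ≠ c.1 := fun h => hcv (eq_of_mem_ends_inr hxy hne hdb hb h ▸ hd)
    have h2 : d'.1 = c.1 := (fst_eq_of_mem_ends_inl hde).trans (fst_eq_of_mem_ends_inl he).symm
    rcases hv' : Φ v with e' | b'
    · rw [hv'] at hd hd'
      exact h1 ((fst_eq_of_mem_ends_inl hd).trans ((fst_eq_of_mem_ends_inl hd').symm.trans h2))
    · have hbb' : b' = b := by
        rw [hv', mem_ends_inr] at hd
        rw [mem_ends_inr] at hdb
        exact Subtype.ext (hd.symm.trans hdb)
      exact hcv (show c ∈ ends x y (Φ v) by rw [hv', hbb']; exact hb)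
  let K : Node m → {K : Set V // Maximal G.IsClique K} := fun c => ⟨_, hmax c⟩
  have hK : ∀ c v, v ∈ (K c).1 ↔ c ∈ ends x y (Φ v) := fun _ _ => Iff.rfl
  have hinj : Function.Injective K := fun c d hcd => by
    have key : ∀ z : Model T y, c ∈ ends x y z → d ∈ ends x y z := fun z hz => by
      have : Φ.symm z ∈ (K c).1 := by simpa [hK] using hz
      rw [hcd] at this
      simpa [hK] using this
    obtain ⟨b, hb⟩ := hp c
    obtain ⟨e, he⟩ := ht c
    exact eq_of_mem_ends_inr hxy hne hb (key _ hb)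
      ((fst_eq_of_mem_ends_inl he).trans (fst_eq_of_mem_ends_inl (key _ he)).symm)
  refine ⟨(cliqueGraph G).comap K, hac.of_comap ⟨K, hinj⟩, fun z c hc d hd hcd => ?_⟩
  exact ⟨hinj.ne hcd, Φ.symm z, by simpa [hK] using hc, by simpa [hK] using hd⟩

/-- The contracted graph has one more pendant edge than tree edges. -/
lemma card_model [Fintype κ] (hT : ∀ i, (T i).IsTree) (hy : Function.Injective y)
    (hκ : Fintype.card κ + 1 = q) :
    Nat.card (Σ i, (T i).edgeSet) + 1 = Nat.card {c : Node m // c ∉ Set.range y} := by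
  classical
  have h1 : Nat.card (Node m) = Nat.card κ + Nat.card {c : Node m // c ∉ Set.range y} := by
    rw [← Nat.card_congr (Equiv.sumCompl (· ∈ Set.range y)), Nat.card_sum,
      Nat.card_congr (Equiv.ofInjective y hy)]
  have h2 : Nat.card (Node m) = Nat.card (Σ i, (T i).edgeSet) + q := by
    have : ∀ i, Nat.card (T i).edgeSet + 1 = m i := fun i => by
      simpa using (SimpleGraph.isTree_iff_connected_and_card.1 (hT i)).2
    rw [Nat.card_sigma, Nat.card_sigma]
    calc ∑ i, Nat.card (Fin (m i)) = ∑ i, (Nat.card (T i).edgeSet + 1) := by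
          simp only [this, Nat.card_fin]
      _ = _ := by simp [sum_add_distrib]
  rw [Nat.card_eq_fintype_card (α := κ)] at h1
  omega

/-- The corollary for a contracted graph with acyclic incidence. The nodes and incidences become a
forest once each pendant edge that has not been contracted is given its pendant vertex as second end,
and in this forest the classes of pendant edges form a perfect matching. -/
theorem associatedPartition_of_model {V : Type*} [Fintype V] {G : SimpleGraph V} (Φ : V ≃ Model T y)
    (hxy : Function.Injective (Sum.elim x y)) (hne : ∀ k, (x k).1 ≠ (y k).1)
    (hG : IsLineGraphOf G (fun v => ends x y (Φ v)))
    (hcard : Nat.card (Σ i, (T i).edgeSet) + 1 = Nat.card {c : Node m // c ∉ Set.range y})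
    {H : SimpleGraph (Node m)} (hH : H.IsAcyclic)
    (hHadj : ∀ z : Model T y, ∀ c ∈ ends x y z, ∀ d ∈ ends x y z, c ≠ d → H.Adj c d) :
    (∃ A B : Finset V, IsAssociatedPartition G A B) ∧
    ∀ A B : Finset V, IsAssociatedPartition G A B →
      (∀ S : Finset V, IsAlphaSet G S ↔ S = B) ∧ (∀ S : Finset V, IsGammaSet G S ↔ S = B) := by
  classical
  set E : V → Finset (Node m ⊕ V) := fun v =>
    (ends x y (Φ v)).disjSum (if #(ends x y (Φ v)) = 1 then {v} else ∅) with hE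
  have hforest : IsForest E := IsForest.of_isAcyclic hH (fun v => ends x y (Φ v))
    (fun v => ends_nonempty _) (fun v => card_ends_le hxy _) (fun v => hHadj _)
    (fun v w _ h => Φ.injective (ends_injective hxy hne h))
  have hlr : ∀ v w c, Sum.inr c ∈ E v → Sum.inr c ∈ E w → v = w := by
    intro v w c hv hw
    have aux : ∀ v, Sum.inr c ∈ E v → c = v := fun v hv => by
      rw [hE, inr_mem_disjSum] at hv
      split_ifs at hv
      · exact mem_singleton.1 hv
      · exact (notMem_empty _ hv).elim
    exact (aux v hv).symm.trans (aux w hw)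
  have hGE : IsLineGraphOf G E := fun v w => by
    rw [hG]
    refine and_congr_right fun hvw => ?_
    rw [not_disjoint_iff, not_disjoint_iff]
    constructor
    · rintro ⟨c, hv, hw⟩
      exact ⟨Sum.inl c, inl_mem_disjSum.2 hv, inl_mem_disjSum.2 hw⟩
    · rintro ⟨c | c, hv, hw⟩
      · exact ⟨c, inl_mem_disjSum.1 hv, inl_mem_disjSum.1 hw⟩
      · exact (hvw (hlr v w c hv hw)).elim
  set B : Finset V := univ.filter (fun v => (Φ v).isRight) with hBdef
  have hBmem : ∀ b, Φ.symm (Sum.inr b) ∈ B := fun b => by simp [hBdef]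
  have hB : IsPerfectMatching E B := by
    constructor
    · intro v hv w hw hvw
      rw [hBdef, mem_filter, Sum.isRight_iff] at hv hw
      obtain ⟨-, b, hb⟩ := hv
      obtain ⟨-, b', hb'⟩ := hw
      rw [disjoint_left]
      rintro (c | c) hcv hcw
      · rw [hE, inl_mem_disjSum] at hcv hcw
        rw [hb, mem_ends_inr] at hcv
        rw [hb', mem_ends_inr] at hcw
        refine hvw (Φ.injective ?_)
        rw [hb, hb', Subtype.ext (hcv.symm.trans hcw)]
      · exact hvw (hlr v w c hcv hcw)
    · rintro v (c | c) hc
      · exact ⟨_, hBmem ⟨_, merge_notMem hxy c⟩, by simp [hE]⟩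
      · refine ⟨v, ?_, hc⟩
        rw [hE, inr_mem_disjSum] at hc
        split_ifs at hc with h1
        · rcases hv : Φ v with e | b
          · rw [hv, card_ends_inl] at h1
            omega
          · simp [hBdef, hv]
        · simp at hc
  refine hGE.associatedPartition hforest hB ?_
  have h1 : #B = Nat.card {c : Node m // c ∉ Set.range y} := by
    have : B = univ.image (Φ.symm ∘ Sum.inr) := by
      ext v
      simp only [hBdef, mem_filter, mem_univ, true_and, mem_image, Sum.isRight_iff,
        Function.comp_apply, Equiv.symm_apply_eq]
      exact exists_congr fun b => eq_comm
    rw [this, card_image_of_injective _ (Φ.symm.injective.comp Sum.inr_injective),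
      Nat.card_eq_fintype_card, card_univ]
  have h2 : Fintype.card V = Nat.card (Σ i, (T i).edgeSet) +
      Nat.card {c : Node m // c ∉ Set.range y} := by
    rw [← Nat.card_eq_fintype_card, Nat.card_congr Φ, Nat.card_sum]
  omega

end Assembly

theorem InFamily.associatedPartition {V : Type*} [Fintype V] {G : SimpleGraph V}
    (hG : InFamily G) :
    (∃ A B : Finset V, IsAssociatedPartition G A B) ∧
    ∀ A B : Finset V, IsAssociatedPartition G A B →
      (∀ S : Finset V, IsAlphaSet G S ↔ S = B) ∧
      (∀ S : Finset V, IsGammaSet G S ↔ S = B) := by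
  obtain ⟨q, m, T, x', y', hq, hT, hs, hinj, htree, ⟨φ⟩⟩ := hG
  have key : ∀ a : LineVertex T, IsSimplicial (corona (T a.1)).lineGraph a.2 →
      ∃ c, a = lineVertexOf T (Sum.inr c) := by
    rintro ⟨i, e, he⟩ h
    obtain ⟨v, hv⟩ := exists_eq_of_isSimplicial h
    exact ⟨⟨i, v⟩, Sigma.ext rfl (heq_of_eq (Subtype.ext hv))⟩
  choose x hx using fun k => key (x' k) (hs k).1
  choose y hy using fun k => key (y' k) (hs k).2.1
  have hxy : Function.Injective (Sum.elim x y) := by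
    have : Sum.elim x' y' = (lineVertexOf T ∘ Sum.inr) ∘ Sum.elim x y := by
      funext k
      rcases k with k | k
      · exact hx k
      · exact hy k
    rw [this] at hinj
    exact hinj.of_comp
  have hne : ∀ k, (x k).1 ≠ (y k).1 := fun k h => by
    have := (hs k).2.2
    rw [hx, hy] at this
    exact this h
  have hline := contractPairs_adj hxy hx hy
  obtain ⟨H, hH, hHadj⟩ : ∃ H : SimpleGraph (Node m), H.IsAcyclic ∧
      ∀ z : Model T y, ∀ c ∈ ends x y z, ∀ d ∈ ends x y z, c ≠ d → H.Adj c d := by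
    rcases hq.eq_or_lt with rfl | hq
    · have : IsEmpty (Fin (1 - 1)) := Fin.isEmpty'
      exact exists_isAcyclic_of_subsingleton fun i => (hT i).2
    · exact exists_isAcyclic_of_cliqueGraph (quotientEquiv T hxy hx hy) hxy hne hT hline
        (htree hq).isAcyclic
  refine associatedPartition_of_model (φ.toEquiv.trans (quotientEquiv T hxy hx hy)) hxy hne
    (fun v w => ?_) (card_model (fun i => (hT i).2) (hxy.comp Sum.inr_injective) ?_) hH hHadj
  · rw [← φ.map_adj_iff, hline, φ.injective.ne_iff]
    rfl
  · rw [Fintype.card_fin]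
    omega

end Favaron

theorem corollary5p6 {V : Type*} [Fintype V] (G : SimpleGraph V) (hG : Favaron.InFamily G) :
    (∃ A B : Finset V, Favaron.IsAssociatedPartition G A B) ∧
    ∀ A B : Finset V, Favaron.IsAssociatedPartition G A B →
      (∀ S : Finset V, Favaron.IsAlphaSet G S ↔ S = B) ∧
      (∀ S : Finset V, Favaron.IsGammaSet G S ↔ S = B) :=
  hG.associatedPartition
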